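/- A *regular $\star$-semigroup* is a semigroup $(S,\cdot)$ with a unary operation $x\mapsto x^\ast$ such that $xx^\ast x=x$, $x^{\ast\ast}=x$ and $(xy)^\ast=y^\ast x^\ast$ for all $x,y\in S$. Let $(S,+,-)$ and $(S,\cdot,\ast)$ be regular $\star$-semigroups on the same set $S$, where $x\mapsto -x$ and $x\mapsto x^\ast$ are the two unary operations; write $x-y$ for $x+(-y)$, and let multiplication bind more strongly than addition and than the operation $-$ (so $-az$ means $-(az)$). Then $(S,+,\cdot,-,\ast)$ is called a *dual weak left $\star$-brace* if, for all $x,y,z\in S$, $$x(y+z)=xy-x+xz,\qquad -x+x=xx^\ast,\qquad x-x=x^\ast x.$$ The set of *right distributors* of such an $S$ is $$\mathcal D_r(S)=\{z\in S\mid (a+b)z=az-z+bz\ \text{ for all } a,b\in S\}.$$ A map $r:S\times S\to S\times S$ is a *set-theoretic solution of the Yang–Baxter equation* if $$(r\times\mathrm{id}_S)(\mathrm{id}_S\times r)(r\times\mathrm{id}_S)=(\mathrm{id}_S\times r)(r\times\mathrm{id}_S)(\mathrm{id}_S\times r)$$ as maps from $S\times S\times S$ to itself. **Theorem.** Let $(S,+,\cdot,-,\ast)$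 be a dual weak left $\star$-brace and let $z\in S$. For $a,b\in S$ put $$\sigma^z_a(b)=z^\ast z\,(-az+abz)\,z^\ast z,\qquad \tau^z_b(a)=(\sigma^z_a(b))^\ast ab,\qquad r^S_z(a,b)=(\sigma^z_a(b),\tau^z_b(a)).$$ Then $r^S_z$ is a set-theoretic solution of the Yang–Baxter equation if and only if $z\in\mathcal D_r(S)$. -/

import Mathlib

/-- A regular `⋆`-semigroup written multiplicatively: a semigroup with a unary operation `star`
satisfying `x x⋆ x = x`, `x⋆⋆ = x` and `(x y)⋆ = y⋆ x⋆` (the last two are part of Mathlib's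
`StarMul`). -/
class RegularStarSemigroup (S : Type*) extends Semigroup S, StarMul S where
  mul_star_mul_self : ∀ x : S, x * star x * x = x

/-- A regular `⋆`-semigroup written additively, with unary operation `x ↦ -x`: a (not necessarily
commutative) semigroup satisfying `x + (-x) + x = x`, `-(-x) = x` (part of `InvolutiveNeg`) and
`-(x + y) = -y + -x`. -/
class RegularStarAddSemigroup (S : Type*) extends AddSemigroup S, InvolutiveNeg S where
  add_neg_add_self : ∀ x : S, x + -x + x = x
  neg_add_eq : ∀ x y : S, -(x + y) = -y + -x

/-- A weak left `⋆`-brace. -/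
class WeakLeftStarBrace (S : Type*) extends RegularStarAddSemigroup S, RegularStarSemigroup S where
  mul_add_eq : ∀ x y z : S, x * (y + z) = x * y + -x + x * z
  neg_add_self_eq : ∀ x : S, -x + x = x * star x

/-- A dual weak left `⋆`-brace. -/
class DualWeakLeftStarBrace (S : Type*) extends WeakLeftStarBrace S where
  add_neg_self_eq : ∀ x : S, x + -x = star x * x

/-- The set `𝒟_r(S)` of right distributors of a dual weak left `⋆`-brace. -/
def rightDistributors (S : Type*) [DualWeakLeftStarBrace S] : Set S :=
  {z | ∀ a b : S, (a + b) * z = a * z + -z + b * z}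

/-- The first component of the deformed map, `σ^z_a(b) = z⋆ z (-(a z) + a b z) z⋆ z`. -/
def deformedSigma {S : Type*} [DualWeakLeftStarBrace S] (z a b : S) : S :=
  star z * z * (-(a * z) + a * b * z) * star z * z

/-- The second component of the deformed map, `τ^z_b(a) = (σ^z_a(b))⋆ a b`. -/
def deformedTau {S : Type*} [DualWeakLeftStarBrace S] (z b a : S) : S :=
  star (deformedSigma z a b) * a * b

/-- The deformed map `r^S_z(a, b) = (σ^z_a(b), τ^z_b(a))`. -/
def deformedMap {S : Type*} [DualWeakLeftStarBrace S] (z : S) : S × S → S × S :=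
  fun p => (deformedSigma z p.1 p.2, deformedTau z p.2 p.1)

/-- The map `r × id` on `S × S × S`. -/
def applyFirstTwo {S : Type*} (r : S × S → S × S) : S × S × S → S × S × S :=
  fun p => ((r (p.1, p.2.1)).1, (r (p.1, p.2.1)).2, p.2.2)

/-- The map `id × r` on `S × S × S`. -/
def applyLastTwo {S : Type*} (r : S × S → S × S) : S × S × S → S × S × S :=
  fun p => (p.1, r p.2)

/-- `r` is a set-theoretic solution of the Yang–Baxter equation:
`(r × id)(id × r)(r × id) = (id × r)(r × id)(id × r)` as maps `S × S × S → S × S × S`. -/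
def IsYangBaxterSolution {S : Type*} (r : S × S → S × S) : Prop :=
  applyFirstTwo r ∘ applyLastTwo r ∘ applyFirstTwo r =
    applyLastTwo r ∘ applyFirstTwo r ∘ applyLastTwo r

/-!
The theorem is reduced to skew left braces, where it is a computation with groups.

*Structure of `S`.* Call `e` a projection if `e * e = e = star e`; the axioms make `-e = e = e + e`.
Expanding products such as `x * (e + e)` and `e * (f + e)` by distributivity shows that addition of
projections is the opposite of multiplication (`proj_mul_proj`) and that the projections generate a
normal band (`proj_mul_assoc_insert`, `proj_sandwich_comm`). Moreover
`x * e * star x = (x * star x) * e * (x * star x)` for every element `x` and projection `e`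
(`conj_proj`), and then `x * e = e + x` and `e * x = x + e` (`mul_proj`, `proj_mul`). Consequently,
for each projection `p`, the compression `x ↦ p * x * p` respects all four operations, and the
elements `x` with `x * star x = p = star x * x` form a skew left brace `MaxSubgroup p`. If `p` lies
below the support of `x`, then `p * x * p` belongs to `MaxSubgroup p`.

*Reduction.* Given finitely many elements, let `p = q * star q`, where `q` is the product of
`star z` with these elements. Both sides of the braid equation, and both sides of the equation
defining right distributors, have the same support as `p` and the same ends, so they agree if and
only if their compressions to `p` do (`eq_compress_mul`). Thus each of the two properties holds for
`z` if and only if it holds in these skew left braces for the compressions of `z`.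

*Skew left braces.* There the product of the components is preserved by the map, and `σ a b * σ τ c`
equals `-(a z) + a b c z` for every `z`. Hence the braid equation is equivalent to the equality of
first components (`SkewBrace.yangBaxter_iff_fst`), which unfolds to the rule
`(-x + y) z = z - x z + y z`, that is, to right distributivity (`SkewBrace.yangBaxter_iff`).
-/

namespace DualWeakLeftStarBrace

variable {S : Type*} [DualWeakLeftStarBrace S]

/-! ### Projections -/

lemma mul_star_mul (x : S) : x * star x * x = x := RegularStarSemigroup.mul_star_mul_self x

lemma add_neg_add (x : S) : x + -x + x = x := RegularStarAddSemigroup.add_neg_add_self x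

/-- Negation reverses sums: addition is not assumed commutative. -/
lemma neg_add' (x y : S) : -(x + y) = -y + -x := RegularStarAddSemigroup.neg_add_eq x y

lemma mul_add' (x y z : S) : x * (y + z) = x * y + -x + x * z := WeakLeftStarBrace.mul_add_eq x y z

lemma neg_add_self' (x : S) : -x + x = x * star x := WeakLeftStarBrace.neg_add_self_eq x

lemma add_neg_self' (x : S) : x + -x = star x * x := DualWeakLeftStarBrace.add_neg_self_eq x

lemma star_mul_star (x : S) : star x * x * star x = star x := by
  simpa using mul_star_mul (star x)

lemma isStarProjection_iff {e : S} : IsStarProjection e ↔ e * e = e ∧ star e = e :=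
  ⟨fun h => ⟨h.1, h.2⟩, fun h => ⟨h.1, h.2⟩⟩

lemma isStarProjection_mul_star (x : S) : IsStarProjection (x * star x) := by
  rw [isStarProjection_iff]
  refine ⟨?_, by simp⟩
  rw [← mul_assoc, mul_star_mul]

lemma isStarProjection_star_mul (x : S) : IsStarProjection (star x * x) := by
  simpa using isStarProjection_mul_star (star x)

lemma isStarProjection_conj (x : S) {e : S} (he : IsStarProjection e) :
    IsStarProjection (x * e * star x) := by
  obtain ⟨h1, h2⟩ := isStarProjection_iff.1 he
  have := isStarProjection_mul_star (x * e)
  rwa [star_mul, h2, ← mul_assoc, mul_assoc x, h1] at this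

lemma isStarProjection_sandwich {e f : S} (he : IsStarProjection e) (hf : IsStarProjection f) :
    IsStarProjection (e * f * e) := by
  have := isStarProjection_conj e hf
  rwa [he.2.star_eq] at this

lemma neg_proj {e : S} (he : IsStarProjection e) : -e = e := by
  have h : -e + e = e := by rw [neg_add_self', he.2.star_eq, he.1.eq]
  calc -e = -(-e + e) := by rw [h]
    _ = -e + e := by rw [neg_add', neg_neg]
    _ = e := h

lemma proj_add_self {e : S} (he : IsStarProjection e) : e + e = e := by
  have h : -e + e = e := by rw [neg_add_self', he.2.star_eq, he.1.eq]
  rwa [neg_proj he] at h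

/-- A product of two projections is idempotent. -/
lemma proj_mul_idem {e f : S} (he : IsStarProjection e) (hf : IsStarProjection f) :
    e * f * e * f = e * f := by
  have := mul_star_mul (e * f)
  rw [star_mul, he.2.star_eq, hf.2.star_eq] at this
  have h1 := he.1.eq
  have h2 := hf.1.eq
  grind

lemma proj_add_idem {e f : S} (he : IsStarProjection e) (hf : IsStarProjection f) :
    e + f + e + f = e + f := by
  have := add_neg_add (e + f)
  rw [neg_add', neg_proj he, neg_proj hf] at this
  have h1 := proj_add_self he
  have h2 := proj_add_self hf
  grind

lemma isStarProjection_add_sandwich {e f : S} (he : IsStarProjection e) (hf : IsStarProjection f) :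
    IsStarProjection (e + f + e) := by
  have := isStarProjection_mul_star (f + e)
  rw [← neg_add_self', neg_add', neg_proj he, neg_proj hf] at this
  have h2 := proj_add_self hf
  have h : e + f + (f + e) = e + f + e := by grind
  rwa [h] at this

/-! ### The band generated by the projections -/

/-- A first formula for `x * e`. Expanding `x * (e + e)` gives `x * e = x * e - x + x * e`, from which
`-(x * e)` is obtained by adding `-(x * e)` on both sides. The last summand turns out to be redundant
and the first one to be replaceable by `e`, see `mul_proj`. -/
lemma mul_proj_aux (x : S) {e : S} (he : IsStarProjection e) :
    x * e = e * (star x * x) * e + x + x * e * star x := by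
  have h1 : x * e = x * e + -x + x * e := by
    conv_lhs => rw [← proj_add_self he, mul_add']
  have h2 : -(x * e) + x * e = x * e * star x := by
    rw [neg_add_self', star_mul, he.2.star_eq, ← mul_assoc, mul_assoc x, he.1.eq]
  have h3 : x * e + -(x * e) = e * (star x * x) * e := by
    rw [add_neg_self', star_mul, he.2.star_eq]; simp only [mul_assoc]
  have h4 := add_neg_add (-(x * e))
  rw [neg_neg] at h4
  have h5 : -(x * e) = x * e * star x + -x + e * (star x * x) * e := by
    rw [← h2, ← h3]; grind
  have h6 := neg_proj (isStarProjection_conj x he)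
  have h7 := neg_proj (isStarProjection_sandwich he (isStarProjection_star_mul x))
  have := congrArg (fun t => -t) h5
  simp only [neg_neg, neg_add', h6, h7] at this
  rw [add_assoc]
  exact this

lemma proj_mul_proj_aux {e f : S} (he : IsStarProjection e) (hf : IsStarProjection f) :
    e * f = f * e * f + e + e * f * e := by
  have := mul_proj_aux e hf
  rwa [he.2.star_eq, he.1.eq] at this

/-- The multiplicative order on projections is contained in the additive one. Otherwise
`g` and `e + g + e` would be distinct projections spanning a 2 × 2 rectangular band, on which
distributivity of `g` over `e + g` fails. -/
lemma add_eq_of_mul_eq {g e : S} (hg : IsStarProjection g) (he : IsStarProjection e)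
    (h : g * e = g) : g + e = g := by
  have h' : e * g = g := by
    have := congrArg star h
    rwa [star_mul, hg.2.star_eq, he.2.star_eq] at this
  have gg := hg.1.eq
  have gga := proj_add_self hg
  have eea := proj_add_self he
  have ng := neg_proj hg
  have ne := neg_proj he
  have a1 : g = g + e + g := by
    have := proj_mul_proj_aux he hg
    rwa [h', h, gg] at this
  obtain ⟨u, hu⟩ : ∃ u, u = g + e := ⟨_, rfl⟩
  obtain ⟨k, hk⟩ : ∃ k, k = e + g + e := ⟨_, rfl⟩
  have pk : IsStarProjection k := hk ▸ isStarProjection_add_sandwich he hg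
  have uk : u * star u = k := by
    rw [← neg_add_self', hu, neg_add', ng, ne]; grind
  have ug' : star u * u = g := by
    rw [← add_neg_self', hu, neg_add', ng, ne]; grind
  have ug : u * g = u := by rw [← ug', ← mul_assoc, mul_star_mul]
  have gu : g * u = g := by rw [hu, mul_add', ng, h, gg, gga, gga]
  have sug : star u * g = g := by
    have := congrArg star gu
    rwa [star_mul, hg.2.star_eq] at this
  have gsu : g * star u = star u := by
    have := congrArg star ug
    rwa [star_mul, hg.2.star_eq] at this
  have gk : g * k = star u := by rw [← uk, ← mul_assoc, gu, gsu]
  have uu : u * u = u := by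
    calc u * u = u * g * u := by rw [ug]
      _ = u := by rw [mul_assoc, gu, ug]
  have kgk : k * g * k = k := by
    rw [← uk]; grind
  have gkg : g * k * g = g := by rw [gk, sug]
  have su : star u = e + g := by
    have := proj_mul_proj_aux hg pk
    rw [kgk, gkg, gk, hk] at this
    clear hk
    grind
  have : star u = g := by
    rw [← gsu, su, mul_add', ng, h, gg, gga, gga]
  have : u = g := by rw [← star_star u, this, hg.2.star_eq]
  rw [← hu, this]

lemma add_eq_of_mul_eq' {g e : S} (hg : IsStarProjection g) (he : IsStarProjection e)
    (h : g * e = g) : e + g = g := by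
  have := congrArg (fun t => -t) (add_eq_of_mul_eq hg he h)
  simpa only [neg_add', neg_proj hg, neg_proj he] using this

lemma proj_mul_proj_eq_sandwich {e f : S} (he : IsStarProjection e) (hf : IsStarProjection f) :
    e * f = f * e * f + e * f * e := by
  have h := proj_mul_proj_aux he hf
  have h1 : e + e * f * e = e * f * e :=
    add_eq_of_mul_eq' (isStarProjection_sandwich he hf) he (by rw [mul_assoc, he.1.eq])
  rwa [add_assoc, h1] at h

/-- The additive order on projections is contained in the multiplicative one. -/
lemma mul_eq_of_add_eq {k e : S} (hk : IsStarProjection k) (he : IsStarProjection e)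
    (h : e + k = k) : k * e = k := by
  have h1 : k * (e + k) = k * e := by
    rw [mul_add', neg_proj hk, hk.1.eq, add_assoc, proj_add_self hk,
      proj_mul_proj_eq_sandwich hk he, add_assoc,
      add_eq_of_mul_eq (isStarProjection_sandwich hk he) hk (by rw [mul_assoc, hk.1.eq])]
  rw [← h1, h, hk.1.eq]

/-- The additive and multiplicative sandwiches of projections agree: `e + f + e` lies below `e` in
the additive order, hence in the multiplicative one, and distributivity evaluates
`e * (e + f + e)`. -/
lemma add_sandwich {e f : S} (he : IsStarProjection e) (hf : IsStarProjection f) :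
    e + f + e = e * f * e := by
  obtain ⟨k, hk⟩ : ∃ k, k = e + f + e := ⟨_, rfl⟩
  obtain ⟨a, ha⟩ : ∃ a, a = e * f * e := ⟨_, rfl⟩
  obtain ⟨b, hb⟩ : ∃ b, b = f * e * f := ⟨_, rfl⟩
  have pk : IsStarProjection k := hk ▸ isStarProjection_add_sandwich he hf
  have pa : IsStarProjection a := ha ▸ isStarProjection_sandwich he hf
  have pb : IsStarProjection b := hb ▸ isStarProjection_sandwich hf he
  have ee := proj_add_self he
  have aa := proj_add_self pa
  have bb := proj_add_self pb
  have hef : e * f = b + a := by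
    rw [ha, hb]
    exact proj_mul_proj_eq_sandwich he hf
  have hae : a + e = a :=
    add_eq_of_mul_eq pa he (by rw [ha, mul_assoc, he.1.eq])
  have ek : e * k = k := by
    have h1 : k * e = k := mul_eq_of_add_eq pk he (by grind)
    have := congrArg star h1
    rwa [star_mul, pk.2.star_eq, he.2.star_eq] at this
  have h2 : k = e + b + a := by
    rw [← ek, hk, add_assoc, mul_add', mul_add', neg_proj he, he.1.eq, hef]
    -- with the definitions cleared, `grind` treats the products as opaque summands
    clear ha hb ek hk
    grind
  have h3 : k = a + b + e := by
    have := congrArg (fun t => -t) h2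
    simp only [neg_add', neg_proj pk, neg_proj pa, neg_proj pb, neg_proj he] at this
    grind
  have h4 : a = a + b + a := by
    have := neg_add_self' (e * f)
    rw [star_mul, he.2.star_eq, hf.2.star_eq, hef, neg_add', neg_proj pa, neg_proj pb,
      ← hef] at this
    have h : e * f * (f * e) = a := by
      rw [ha, mul_assoc, ← mul_assoc f, hf.1.eq, mul_assoc]
    rw [h, hef] at this
    clear ha hb hef hk
    grind
  have h5 : k + a = k := by
    rw [h2]
    clear ha hb hef hk h2 h3 h4 ek
    grind
  have h6 : k + a = a := by
    rw [h3]
    clear hb hef hk h2 h3 h5 ek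
    have := add_eq_of_mul_eq' pa he (by rw [ha, mul_assoc, he.1.eq])
    clear ha
    grind
  rw [← hk, ← ha, ← h5, h6]

/-- On projections, addition is the opposite of multiplication. -/
lemma proj_mul_proj {e f : S} (he : IsStarProjection e) (hf : IsStarProjection f) :
    e * f = f + e := by
  have := proj_add_idem hf he
  rw [proj_mul_proj_eq_sandwich he hf, ← add_sandwich he hf, ← add_sandwich hf he]
  have := proj_add_self he
  grind

/-- The band generated by the projections satisfies this identity because `e * (g + f)` can be
evaluated by distributivity or by `g + f = f * g`. -/
lemma proj_mul_assoc_insert {e f g : S} (he : IsStarProjection e) (hf : IsStarProjection f)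
    (hg : IsStarProjection g) : e * f * e * g = e * f * g := by
  rw [proj_mul_proj (isStarProjection_sandwich he hf) hg, ← add_sandwich he hf,
    mul_assoc e f g, proj_mul_proj hf hg, mul_add', neg_proj he, proj_mul_proj he hg,
    proj_mul_proj he hf]
  have := proj_add_self he
  grind

lemma proj_mul_assoc_insert' {e f g : S} (he : IsStarProjection e) (hf : IsStarProjection f)
    (hg : IsStarProjection g) : g * e * f * e = g * f * e := by
  have := congrArg star (proj_mul_assoc_insert he hf hg)
  simpa only [star_mul, he.2.star_eq, hf.2.star_eq, hg.2.star_eq, ← mul_assoc] using this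

/-- Normality of the band generated by the projections. -/
lemma proj_sandwich_comm {e f g : S} (he : IsStarProjection e) (hf : IsStarProjection f)
    (hg : IsStarProjection g) : e * f * g * e = e * g * f * e := by
  rw [← proj_mul_assoc_insert' hg hf he]
  simp only [mul_assoc]
  congr 1
  simpa only [mul_assoc] using proj_mul_assoc_insert hg hf he

/-! ### Projections and arbitrary elements -/

/-- The projection `star x * p * x` lies below the sandwich of `p` by `star x * x`, because
`p * x = p * ((x - x) + x)` forces `p * x` to be fixed by adding `(x - x) + p` on the left. -/
lemma star_conj_mul_sandwich (x : S) {p : S} (hp : IsStarProjection p) :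
    star x * p * x * (star x * x * p * (star x * x)) = star x * p * x := by
  have pf := isStarProjection_star_mul x
  have pm : IsStarProjection (star x * p * x) := by
    simpa using isStarProjection_conj (star x) hp
  have h1 : star x * x + p + p * x = p * x := by
    conv_rhs => rw [← add_neg_add x, add_neg_self', mul_add', neg_proj hp, proj_mul_proj hp pf]
    have := proj_add_self hp
    grind
  have h2 : p * x + -(p * x) = star x * p * x := by
    rw [add_neg_self', star_mul, hp.2.star_eq, mul_assoc, ← mul_assoc p, hp.1.eq, mul_assoc]
  have h3 : star x * x + p + star x * p * x = star x * p * x := by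
    conv_rhs => rw [← h2, ← h1]
    rw [← h2]
    grind
  have h4 : star x * x + star x * p * x = star x * p * x := by
    rw [← proj_mul_proj pm pf, ← mul_assoc, mul_assoc _ x, mul_assoc _ (x * star x), mul_star_mul]
  rw [proj_mul_proj pm (isStarProjection_sandwich pf hp), ← add_sandwich pf hp,
    add_assoc _ _ (star x * p * x), h4, h3]

lemma conj_mul_sandwich (x : S) {e : S} (he : IsStarProjection e) :
    x * e * star x * (x * star x * e * (x * star x)) = x * e * star x := by
  simpa using star_conj_mul_sandwich (star x) he

/-- The two projections of an element lie in the same rectangle of the band of idempotents. -/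
lemma range_source_range (x : S) :
    x * star x * (star x * x) * (x * star x) = x * star x := by
  have h := conj_mul_sandwich x (isStarProjection_star_mul x)
  have h' : x * (star x * x) * star x = x * star x := by rw [← mul_assoc, mul_star_mul]
  have h2 := (isStarProjection_mul_star x).1.eq
  rw [h'] at h
  grind

lemma source_range_source (x : S) :
    star x * x * (x * star x) * (star x * x) = star x * x := by
  simpa using range_source_range (star x)

lemma sandwich_mul_sandwich {d e g : S} (hd : IsStarProjection d) (he : IsStarProjection e)
    (hg : IsStarProjection g) : d * e * d * (d * g * d) = d * e * g * d := by
  have := hd.1.eq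
  have := proj_mul_assoc_insert hd he hg
  grind

/-- The conjugate of a projection by `x` depends on `x` only through `x * star x`. Conjugations by
`x` and by `star x` are mutually inverse on the projections below `star x * x` and `x * star x`,
and each is bounded above by a sandwich; since these sandwiches are mutually inverse too, both
bounds are equalities. -/
lemma conj_proj (x : S) {e : S} (he : IsStarProjection e) :
    x * e * star x = x * star x * e * (x * star x) := by
  obtain ⟨d, hd⟩ : ∃ d, d = x * star x := ⟨_, rfl⟩
  obtain ⟨f, hf⟩ : ∃ f, f = star x * x := ⟨_, rfl⟩
  obtain ⟨g, hg⟩ : ∃ g, g = f * e * f := ⟨_, rfl⟩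
  obtain ⟨r, hr⟩ : ∃ r, r = x * e * star x := ⟨_, rfl⟩
  have pd : IsStarProjection d := hd ▸ isStarProjection_mul_star x
  have pf : IsStarProjection f := hf ▸ isStarProjection_star_mul x
  have pg : IsStarProjection g := hg ▸ isStarProjection_sandwich pf he
  have pr : IsStarProjection r := hr ▸ isStarProjection_conj x he
  have xf : x * f = x := by rw [hf, ← mul_assoc, mul_star_mul]
  have fx : f * star x = star x := by rw [hf, star_mul_star]
  have dx : d * x = x := by rw [hd, mul_star_mul]
  have xd : star x * d = star x := by rw [hd, ← mul_assoc, star_mul_star]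
  have rg : r = x * g * star x := by
    rw [hr, hg]; grind
  have gr : g = star x * r * x := by
    rw [hr, hg, hf]; simp only [mul_assoc]
  have dr : d * r = r := by rw [hr, ← mul_assoc, ← mul_assoc, dx]
  have rd : r * d = r := by rw [hr, mul_assoc, xd]
  have dfd : d * f * d = d := by rw [hd, hf, range_source_range]
  have h1 : r * (d * g * d) = r := by
    have := conj_mul_sandwich x pg
    rwa [← rg, ← hd] at this
  have h2 : g * (f * r * f) = g := by
    have := star_conj_mul_sandwich x pr
    rwa [← gr, ← hf] at this
  -- the sandwich of `f r f` by `d` is `r`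
  have h3 : d * (f * r * f) * d = r := by
    have a1 := proj_mul_assoc_insert pd pf pr
    have a2 := proj_mul_assoc_insert' pd pf pr
    rw [dfd] at a1
    calc d * (f * r * f) * d = d * f * r * f * d := by simp only [mul_assoc]
      _ = d * (r * f * d) := by rw [← a1]; simp only [mul_assoc]
      _ = d * (r * (d * f * d)) := by rw [← a2]; simp only [mul_assoc]
      _ = r := by rw [dfd, rd, dr]
  have h4 : d * g * d * r = d * g * d := by
    have := sandwich_mul_sandwich pd pg (isStarProjection_sandwich pf pr)
    rwa [h3, mul_assoc d g (f * r * f), h2] at this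
  have h5 : r * (d * g * d) = d * g * d := by
    have := congrArg star h4
    rwa [star_mul, (isStarProjection_sandwich pd pg).2.star_eq, pr.2.star_eq] at this
  have h6 : d * g * d = d * e * d := by
    have a1 := proj_mul_assoc_insert pd pf he
    have a2 := proj_mul_assoc_insert' pd pf he
    rw [dfd] at a1
    calc d * g * d = d * f * e * f * d := by rw [hg]; simp only [mul_assoc]
      _ = d * (e * f * d) := by rw [← a1]; simp only [mul_assoc]
      _ = d * (e * (d * f * d)) := by rw [← a2]; simp only [mul_assoc]
      _ = d * e * d := by rw [dfd, mul_assoc]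
  rw [← hr, ← hd, ← h6, ← h5, h1]

/-- Multiplying by a projection on the right is adding it on the left. -/
lemma mul_proj (x : S) {e : S} (he : IsStarProjection e) : x * e = e + x := by
  obtain ⟨d, hd⟩ : ∃ d, d = x * star x := ⟨_, rfl⟩
  obtain ⟨f, hf⟩ : ∃ f, f = star x * x := ⟨_, rfl⟩
  have pd : IsStarProjection d := hd ▸ isStarProjection_mul_star x
  have pf : IsStarProjection f := hf ▸ isStarProjection_star_mul x
  have dfd : d * f * d = d := by rw [hd, hf, range_source_range]
  have ne := neg_proj he
  have ee := proj_add_self he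
  have h1 : x * e = e + x + d * e * d := by
    rw [mul_proj_aux x he, conj_proj x he, ← hd, ← hf, ← add_sandwich he pf]
    have h : f + x = x := by rw [hf, ← add_neg_self', add_neg_add]
    have := proj_add_idem he pf
    clear hf hd
    grind
  -- it remains to absorb `d * e * d` into `y = e + x`, that is, to bound `q = -y + y` by it
  obtain ⟨y, hy⟩ : ∃ y, y = e + x := ⟨_, rfl⟩
  obtain ⟨q, hq⟩ : ∃ q, q = y * star y := ⟨_, rfl⟩
  have pq : IsStarProjection q := hq ▸ isStarProjection_mul_star y
  have hq' : q = -y + y := by rw [hq, neg_add_self']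
  have hs : star y * y = e * f * e := by
    rw [← add_neg_self', hy, neg_add', ne, ← add_sandwich he pf, hf, ← add_neg_self']
    grind
  have hqe : q * (e * f * e) * q = q := by
    rw [hq, ← hs, range_source_range]
  have hqd : q * d = q := by
    rw [proj_mul_proj pq pd, hq', hy, neg_add', ne, hd, ← neg_add_self']
    have h := add_neg_add (-x)
    rw [neg_neg] at h
    grind
  have hdq : d * q = q := by
    have := congrArg star hqd
    rwa [star_mul, pd.2.star_eq, pq.2.star_eq] at this
  have hde : d * (e * f * e) * d = d * e * d := by
    have a1 := proj_mul_assoc_insert' he pf pd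
    have a2 := sandwich_mul_sandwich pd pf he
    rw [dfd] at a2
    calc d * (e * f * e) * d = d * e * f * e * d := by simp only [mul_assoc]
      _ = d * (d * e * d) := by rw [a1, a2]
      _ = d * e * d := by simp only [← mul_assoc, pd.1.eq]
  have hqd' : d * e * d * q = q := by
    have h : q * (d * e * d) = d * e * d * q := by
      have a1 := sandwich_mul_sandwich pd pq he
      have a2 := sandwich_mul_sandwich pd he pq
      rw [proj_sandwich_comm pd he pq, ← a1, hdq, hqd] at a2
      exact a2.symm
    calc d * e * d * q = q * (d * e * d) * q := by rw [h, mul_assoc _ q, pq.1.eq]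
      _ = (q * d) * (e * f * e) * (d * q) := by rw [← hde]; simp only [mul_assoc]
      _ = q := by rw [hqd, hdq, hqe]
  have pded := isStarProjection_sandwich pd he
  have : q + d * e * d = q := by rw [← proj_mul_proj pded pq, hqd']
  rw [h1, ← hy]
  calc y + d * e * d = y + (-y + y) + d * e * d := by rw [← add_assoc, add_neg_add]
    _ = y := by rw [← hq', add_assoc, this, hq', ← add_assoc, add_neg_add]

/-- Multiplying by a projection on the left is adding it on the right. -/
lemma proj_mul (x : S) {e : S} (he : IsStarProjection e) : e * x = x + e := by
  have pd := isStarProjection_mul_star x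
  have ne := neg_proj he
  have ee := proj_add_self he
  have h1 : e * (x + e) = e * x := by
    have h : -(e * x) + e * x = e * (x * star x) * e := by
      rw [neg_add_self', star_mul, he.2.star_eq]; simp only [mul_assoc]
    have h' : e * (x * star x) * e + e = e * (x * star x) * e :=
      add_eq_of_mul_eq (isStarProjection_sandwich he pd) he (by rw [mul_assoc _ e, he.1.eq])
    rw [mul_add', ne, he.1.eq, add_assoc, ee]
    calc e * x + e = e * x + (-(e * x) + e * x + e) := by simp only [← add_assoc, add_neg_add]
      _ = e * x := by rw [h, h', ← h, ← add_assoc, add_neg_add]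
  have h2 : e * (x + e) = x + e := by
    have h : (x + e) * star (x + e) = e * (x * star x) * e := by
      rw [← neg_add_self', neg_add', ne, ← add_sandwich he pd, ← neg_add_self' x]
      simp only [add_assoc]
    have := mul_star_mul (x + e)
    rw [h] at this
    rw [← this]
    simp only [← mul_assoc, he.1.eq]
  rw [← h1, h2]

/-! ### Compression to a projection -/

/-- Projections of one sandwich are transparent inside products; hence `x ↦ p * x * p` respects
multiplication. -/
lemma mul_proj_mul (x y : S) {p : S} (hp : IsStarProjection p) : p * x * p * y = p * x * y := by
  obtain ⟨f, hf⟩ : ∃ f, f = star x * x := ⟨_, rfl⟩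
  obtain ⟨g, hg⟩ : ∃ g, g = y * star y := ⟨_, rfl⟩
  have pf : IsStarProjection f := hf ▸ isStarProjection_star_mul x
  have pg : IsStarProjection g := hg ▸ isStarProjection_mul_star y
  have hpx : p * x = p * x * (f * p * f) := by
    have h : star x * p * x = f * p * f := by
      rw [hf]; simpa using conj_proj (star x) hp
    rw [← h]
    conv_lhs => rw [← mul_star_mul (p * x), star_mul, hp.2.star_eq]
    have := hp.1.eq
    clear hf hg h
    grind
  have hy : y = g * y := by rw [hg, mul_star_mul]
  have a1 := proj_mul_assoc_insert pf hp pg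
  have a2 := proj_mul_idem pf hp
  calc p * x * p * y = p * x * (f * p * f * p * g) * y := by
        conv_lhs => rw [hpx, hy]
        simp only [mul_assoc]
    _ = p * x * (f * p * f * g) * y := by rw [a2, a1]
    _ = p * x * y := by
        conv_rhs => rw [hpx, hy]
        simp only [mul_assoc]

lemma add_proj_add (x y : S) {p : S} (hp : IsStarProjection p) :
    x + p + y + p = x + y + p := by
  have h := mul_add' p x y
  rw [neg_proj hp, proj_mul _ hp, proj_mul _ hp, proj_mul _ hp] at h
  have := proj_add_self hp
  grind

lemma compress_mul {p : S} (hp : IsStarProjection p) (x y : S) :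
    p * (x * y) * p = p * x * p * (p * y * p) := by
  have h1 := mul_proj_mul x y hp
  have h2 := hp.1.eq
  grind

lemma compress_eq_add {p : S} (hp : IsStarProjection p) (x : S) : p * x * p = p + x + p := by
  rw [mul_proj _ hp, proj_mul _ hp, add_assoc]

lemma compress_add {p : S} (hp : IsStarProjection p) (x y : S) :
    p * (x + y) * p = p * x * p + p * y * p := by
  rw [compress_eq_add hp, compress_eq_add hp, compress_eq_add hp]
  have h1 := add_proj_add x y hp
  have h2 := proj_add_self hp
  grind

lemma compress_neg {p : S} (hp : IsStarProjection p) (x : S) : p * -x * p = -(p * x * p) := by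
  rw [compress_eq_add hp, compress_eq_add hp, neg_add', neg_add', neg_proj hp, add_assoc]

lemma compress_star {p : S} (hp : IsStarProjection p) (x : S) :
    p * star x * p = star (p * x * p) := by
  rw [star_mul, star_mul, hp.2.star_eq, mul_assoc]

/-! ### Supports -/

lemma mul_range (x y : S) :
    x * y * star (x * y) = x * star x * (y * star y) * (x * star x) := by
  rw [← conj_proj x (isStarProjection_mul_star y), star_mul]
  simp only [mul_assoc]

lemma add_range (x y : S) :
    (x + y) * star (x + y) = y * star y * (x * star x) * (y * star y) := by
  have px := isStarProjection_mul_star x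
  rw [← conj_proj y px]
  have h : y * (x * star x) * star (y * (x * star x)) = y * (x * star x) * star y := by
    rw [star_mul, px.2.star_eq, mul_assoc y, ← mul_assoc (x * star x), px.1.eq, ← mul_assoc]
  rw [← h, mul_proj y px, ← neg_add_self', ← neg_add_self', neg_add', neg_add', neg_proj px]
  have h1 := proj_add_self px
  have h2 := neg_add_self' x
  grind

lemma neg_range (x : S) : -x * star (-x) = star x * x := by
  rw [← neg_add_self', neg_neg, add_neg_self']

/-- `Supp d x`, for a projection `d`, says that `d` lies below `x` in the semilattice quotient of
`S`: sandwiching the projection `x * star x` by `d` gives back `d`. Using `star x * x` instead gives the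
same notion, see `supp_star`. -/
def Supp (d x : S) : Prop := d * (x * star x) * d = d

lemma sandwich_sandwich_eq_iff {d e f : S} (hd : IsStarProjection d) (he : IsStarProjection e)
    (hf : IsStarProjection f) : d * (e * f * e) * d = d ↔ d * e * d = d ∧ d * f * d = d := by
  have h : d * (e * f * e) * d = d * e * d * (d * f * d) := by
    rw [sandwich_mul_sandwich hd he hf, proj_sandwich_comm hd he hf,
      ← proj_mul_assoc_insert' he hf hd]
    simp only [mul_assoc]
  have pA := isStarProjection_sandwich hd he
  have pB := isStarProjection_sandwich hd hf
  rw [h]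
  constructor
  · intro hAB
    have hA : d * e * d = d := by
      calc d * e * d = d * e * d * (d * e * d * (d * f * d)) := by
            rw [hAB, mul_assoc _ d d, hd.1.eq]
        _ = d := by rw [← mul_assoc, pA.1.eq, hAB]
    refine ⟨hA, ?_⟩
    rwa [hA, ← mul_assoc, ← mul_assoc, hd.1.eq] at hAB
  · rintro ⟨h1, h2⟩
    rw [h1, h2, hd.1.eq]

lemma supp_mul {d : S} (hd : IsStarProjection d) (x y : S) :
    Supp d (x * y) ↔ Supp d x ∧ Supp d y := by
  unfold Supp
  rw [mul_range]
  exact sandwich_sandwich_eq_iff hd (isStarProjection_mul_star x) (isStarProjection_mul_star y)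

lemma supp_add {d : S} (hd : IsStarProjection d) (x y : S) :
    Supp d (x + y) ↔ Supp d x ∧ Supp d y := by
  unfold Supp
  rw [add_range, and_comm]
  exact sandwich_sandwich_eq_iff hd (isStarProjection_mul_star y) (isStarProjection_mul_star x)

lemma supp_star {d : S} (hd : IsStarProjection d) (x : S) : Supp d (star x) ↔ Supp d x := by
  have key : ∀ y : S, Supp d y → Supp d (star y) := by
    intro y hy
    rw [Supp, star_star]
    rw [Supp, ← range_source_range, sandwich_sandwich_eq_iff hd (isStarProjection_mul_star y)
      (isStarProjection_star_mul y)] at hy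
    exact hy.2
  exact ⟨fun h => by simpa using key _ h, key x⟩

lemma supp_neg {d : S} (hd : IsStarProjection d) (x : S) : Supp d (-x) ↔ Supp d x := by
  rw [← supp_star hd x, Supp, Supp, neg_range, star_star]

lemma supp_sigma {d : S} (hd : IsStarProjection d) (z a b : S) :
    Supp d (deformedSigma z a b) ↔ Supp d z ∧ Supp d a ∧ Supp d b := by
  simp only [deformedSigma, supp_mul hd, supp_add hd, supp_neg hd, supp_star hd]
  tauto

lemma supp_tau {d : S} (hd : IsStarProjection d) (z b a : S) :
    Supp d (deformedTau z b a) ↔ Supp d z ∧ Supp d a ∧ Supp d b := by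
  simp only [deformedTau, supp_sigma hd, supp_mul hd, supp_star hd]
  tauto

lemma supp_self (x : S) : Supp (x * star x) x := by
  rw [Supp, (isStarProjection_mul_star x).1.eq, (isStarProjection_mul_star x).1.eq]

/-- An element which starts under `e` and ends under `k` is determined by its compression to any
projection `p` below `e` over its support. -/
lemma eq_compress_mul {p e k w : S} (hp : IsStarProjection p) (he : IsStarProjection e)
    (hk : IsStarProjection k) (hpe : p * e = p) (hw : e * w = w) (hwk : w * k = w)
    (hs : w * star w * p * (w * star w) = w * star w) : w = p * w * p * k := by
  obtain ⟨d, hd⟩ : ∃ d, d = w * star w := ⟨_, rfl⟩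
  obtain ⟨f, hf⟩ : ∃ f, f = star w * w := ⟨_, rfl⟩
  have pd : IsStarProjection d := hd ▸ isStarProjection_mul_star w
  have pf : IsStarProjection f := hf ▸ isStarProjection_star_mul w
  rw [← hd] at hs
  have hep : e * p = p := by
    have := congrArg star hpe
    rwa [star_mul, hp.2.star_eq, he.2.star_eq] at this
  have hed : e * d = d := by rw [hd, ← mul_assoc, hw]
  have hde : d * e = d := by
    have := congrArg star hed
    rwa [star_mul, pd.2.star_eq, he.2.star_eq] at this
  have hpd : p * d = d * p := by
    have := proj_sandwich_comm he hp pd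
    rwa [hep, mul_assoc, hde, hed, mul_assoc, hpe] at this
  have hpd' : p * d = d := by
    rw [mul_assoc, hpd, ← mul_assoc, pd.1.eq] at hs
    rw [hpd, hs]
  have hpw : p * w = w := by
    have h : w = d * w := by rw [hd, mul_star_mul]
    rw [h, ← mul_assoc, hpd']
  have hfpf : f * p * f = f := by
    have h : Supp f p := by
      have : Supp f d := by
        rw [Supp, pd.2.star_eq, pd.1.eq, hf, hd, source_range_source]
      rw [← hs, supp_mul pf, supp_mul pf] at this
      exact this.1.2
    rwa [Supp, hp.2.star_eq, hp.1.eq] at h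
  have hfk : f * k = f := by rw [hf, mul_assoc, hwk]
  have hfpk : f * p * k = f := by
    rw [← proj_mul_assoc_insert pf hp hk, hfpf, hfk]
  have hwf : w * f = w := by rw [hf, ← mul_assoc, mul_star_mul]
  rw [hpw]
  calc w = w * (f * p * k) := by rw [hfpk, hwf]
    _ = w * p * k := by rw [← mul_assoc, ← mul_assoc, hwf]

/-! ### Maximal subgroups -/

/-- The elements both of whose projections are `p`. It is the maximal subgroup at `p` for both
operations at once, hence a skew left brace with `p` as common identity. -/
def MaxSubgroup (p : {p : S // IsStarProjection p}) : Type _ :=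
  {x : S // x * star x = p ∧ star x * x = p}

namespace MaxSubgroup

variable {p : {p : S // IsStarProjection p}}

/-- The underlying element. -/
def val (x : MaxSubgroup p) : S := Subtype.val x

lemma val_injective : Function.Injective (val : MaxSubgroup p → S) := Subtype.val_injective

lemma mul_star_val (x : MaxSubgroup p) : x.val * star x.val = p := x.2.1

lemma star_mul_val (x : MaxSubgroup p) : star x.val * x.val = p := x.2.2

lemma proj_mul_val (x : MaxSubgroup p) : p * x.val = x.val := by
  rw [← mul_star_val x, mul_star_mul]

lemma val_mul_proj (x : MaxSubgroup p) : x.val * p = x.val := by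
  rw [← star_mul_val x, ← mul_assoc, mul_star_mul]

lemma proj_add_val (x : MaxSubgroup p) : p + x.val = x.val := by
  rw [← mul_proj _ p.2, val_mul_proj]

lemma val_add_proj (x : MaxSubgroup p) : x.val + p = x.val := by
  rw [← proj_mul _ p.2, proj_mul_val]

lemma neg_add_val (x : MaxSubgroup p) : -x.val + x.val = p := by
  rw [neg_add_self', mul_star_val]

lemma add_neg_val (x : MaxSubgroup p) : x.val + -x.val = p := by
  rw [add_neg_self', star_mul_val]

instance : Group (MaxSubgroup p) where
  mul x y := ⟨x.val * y.val, by
    rw [mul_range, mul_star_val, mul_star_val, p.2.1.eq, p.2.1.eq], by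
    have := mul_range (star y.val) (star x.val)
    rw [← star_mul, star_star, star_star, star_star, star_mul_val, star_mul_val, p.2.1.eq,
      p.2.1.eq] at this
    exact this⟩
  one := ⟨p, by rw [p.2.2.star_eq, p.2.1.eq], by rw [p.2.2.star_eq, p.2.1.eq]⟩
  inv x := ⟨star x.val, by rw [star_star, star_mul_val], by rw [star_star, mul_star_val]⟩
  mul_assoc x y z := val_injective (mul_assoc x.val y.val z.val)
  one_mul x := val_injective (proj_mul_val x)
  mul_one x := val_injective (val_mul_proj x)
  inv_mul_cancel x := val_injective (star_mul_val x)

instance : Zero (MaxSubgroup p) :=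
  ⟨⟨p, by rw [p.2.2.star_eq, p.2.1.eq], by rw [p.2.2.star_eq, p.2.1.eq]⟩⟩

instance : Add (MaxSubgroup p) where
  add x y := ⟨x.val + y.val, by
    rw [add_range, mul_star_val, mul_star_val, p.2.1.eq, p.2.1.eq], by
    rw [← add_neg_self', neg_add', add_assoc, ← add_assoc y.val, add_neg_val, ← add_assoc,
      val_add_proj, add_neg_val]⟩

instance : Neg (MaxSubgroup p) where
  neg x := ⟨-x.val, by rw [neg_range, star_mul_val], by
    rw [← add_neg_self', neg_neg, neg_add_val]⟩

instance : AddGroup (MaxSubgroup p) where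
  add_assoc x y z := val_injective (add_assoc x.val y.val z.val)
  zero_add x := val_injective (proj_add_val x)
  add_zero x := val_injective (val_add_proj x)
  neg_add_cancel x := val_injective (neg_add_val x)
  nsmul := nsmulRec
  zsmul := zsmulRec

lemma val_mul (x y : MaxSubgroup p) : (x * y).val = x.val * y.val := rfl
lemma val_add (x y : MaxSubgroup p) : (x + y).val = x.val + y.val := rfl
lemma val_neg (x : MaxSubgroup p) : (-x).val = -x.val := rfl

lemma mul_add_eq (x y z : MaxSubgroup p) : x * (y + z) = x * y + -x + x * z :=
  val_injective (mul_add' x.val y.val z.val)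

lemma compress_val (x : MaxSubgroup p) : p * x.val * p = x.val := by
  rw [proj_mul_val, val_mul_proj]

/-- The compression of `x` to a projection `p` in its support, as an element of the maximal subgroup
at `p`. -/
def ofSupp (x : S) (hx : Supp p.1 x) : MaxSubgroup p := ⟨p * x * p, by
    have h := hx
    have hp := p.2.1.eq
    rw [Supp] at h
    rw [star_mul, star_mul, p.2.2.star_eq]
    have h2 := conj_proj x p.2
    calc p.1 * x * p * (p * (star x * p)) = p * (x * p * star x) * p := by grind
      _ = p * (x * star x) * p * (x * star x) * p := by rw [h2]; simp only [mul_assoc]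
      _ = p := by rw [h, h], by
    have h := (supp_star p.2 x).2 hx
    have hp := p.2.1.eq
    rw [Supp, star_star] at h
    rw [star_mul, star_mul, p.2.2.star_eq]
    have h2 := conj_proj (star x) p.2
    rw [star_star] at h2
    calc p.1 * (star x * p) * (p * x * p) = p * (star x * p * x) * p := by grind
      _ = p * (star x * x) * p * (star x * x) * p := by rw [h2]; simp only [mul_assoc]
      _ = p := by rw [h, h]⟩

lemma val_ofSupp (x : S) (hx : Supp p.1 x) : (ofSupp x hx).val = p * x * p := rfl

end MaxSubgroup

end DualWeakLeftStarBrace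

/-! ### Maps intertwining two braidings -/

section YangBaxter

variable {X Y : Type*}

lemma map_applyFirstTwo {r : X × X → X × X} {r' : Y × Y → Y × Y} {φ : X → Y}
    (h : ∀ x, Prod.map φ φ (r x) = r' (Prod.map φ φ x)) (t : X × X × X) :
    Prod.map φ (Prod.map φ φ) (applyFirstTwo r t) =
      applyFirstTwo r' (Prod.map φ (Prod.map φ φ) t) := by
  have := h (t.1, t.2.1)
  simp only [Prod.map, Prod.ext_iff] at this
  exact Prod.ext this.1 (Prod.ext this.2 rfl)

lemma map_applyLastTwo {r : X × X → X × X} {r' : Y × Y → Y × Y} {φ : X → Y}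
    (h : ∀ x, Prod.map φ φ (r x) = r' (Prod.map φ φ x)) (t : X × X × X) :
    Prod.map φ (Prod.map φ φ) (applyLastTwo r t) =
      applyLastTwo r' (Prod.map φ (Prod.map φ φ) t) :=
  Prod.ext rfl (h t.2)

end YangBaxter

/-! ### Skew left braces -/

namespace SkewBrace

variable {G : Type*} [Group G] [AddGroup G]

/-- The first component of the deformed map; the identities `star z * z` are now trivial. -/
def sigma (z a b : G) : G := -(a * z) + a * b * z

/-- The second component of the deformed map, defined by `sigma z a b * tau z b a = a * b`. -/
def tau (z b a : G) : G := (sigma z a b)⁻¹ * a * b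

/-- The deformed map of a skew left brace. -/
def deformed (z : G) : G × G → G × G := fun p => (sigma z p.1 p.2, tau z p.2 p.1)

lemma sigma_mul_tau (z a b : G) : sigma z a b * tau z b a = a * b := by
  simp [tau, mul_assoc]

lemma mul_zero_eq (h : ∀ x y z : G, x * (y + z) = x * y + -x + x * z) (x : G) : x * 0 = x := by
  have := h x 0 0
  rw [add_zero, add_assoc, left_eq_add, neg_add_eq_zero] at this
  exact this.symm

lemma zero_eq_one (h : ∀ x y z : G, x * (y + z) = x * y + -x + x * z) : (0 : G) = 1 := by
  simpa using mul_zero_eq h (1 : G)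

lemma mul_neg_eq (h : ∀ x y z : G, x * (y + z) = x * y + -x + x * z) (x y : G) :
    x * -y = x + -(x * y) + x := by
  have := h x y (-y)
  rw [add_neg_cancel, mul_zero_eq h] at this
  simpa using eq_neg_add_of_add_eq this.symm

/-- For given `a`, the product depends on `b` and `c` only through `b * c`, whatever `z` is. Hence in the braid
equation the second components agree as soon as the first ones do. -/
lemma sigma_mul_sigma (h : ∀ x y z : G, x * (y + z) = x * y + -x + x * z) (z a b c : G) :
    sigma z a b * sigma z (tau z b a) c = -(a * z) + a * b * c * z := by
  conv_lhs => rw [sigma.eq_1 z (tau z b a) c, h, mul_neg_eq h]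
  simp only [← mul_assoc, sigma_mul_tau]
  rw [sigma]
  simp [add_assoc]

/-- The braid equation holds as soon as the first components agree: the product of the first two
components is then forced by `sigma_mul_sigma`, and the product of all three is preserved by the
map. -/
lemma yangBaxter_iff_fst (h : ∀ x y z : G, x * (y + z) = x * y + -x + x * z) (z : G) :
    IsYangBaxterSolution (deformed z) ↔
    ∀ a b c, sigma z (sigma z a b) (sigma z (tau z b a) c) = sigma z a (sigma z b c) := by
  rw [IsYangBaxterSolution, funext_iff]
  constructor
  · intro H a b c
    exact congrArg Prod.fst (H (a, b, c))
  · rintro H ⟨a, b, c⟩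
    have h1 := H a b c
    have h2 : tau z (sigma z (tau z b a) c) (sigma z a b) =
        sigma z (tau z (sigma z b c) a) (tau z c b) := by
      have e1 := sigma_mul_tau z (sigma z a b) (sigma z (tau z b a) c)
      have e2 := sigma_mul_sigma h z a (sigma z b c) (tau z c b)
      rw [mul_assoc a, sigma_mul_tau, ← mul_assoc] at e2
      rw [h1, sigma_mul_sigma h, ← e2] at e1
      exact mul_left_cancel e1
    have h3 : tau z c (tau z b a) = tau z (tau z c b) (tau z (sigma z b c) a) := by
      have e1 := sigma_mul_tau z (sigma z a b) (sigma z (tau z b a) c)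
      have e2 : sigma z a b * (sigma z (tau z b a) c * tau z c (tau z b a)) = a * b * c := by
        rw [sigma_mul_tau, ← mul_assoc, sigma_mul_tau]
      have e3 : sigma z a (sigma z b c) * (sigma z (tau z (sigma z b c) a) (tau z c b) *
          tau z (tau z c b) (tau z (sigma z b c) a)) = a * b * c := by
        rw [sigma_mul_tau, ← mul_assoc, sigma_mul_tau, mul_assoc, sigma_mul_tau, mul_assoc]
      rw [← mul_assoc, ← e1, h1, h2, ← e3, ← mul_assoc] at e2
      exact mul_left_cancel e2
    exact Prod.ext h1 (Prod.ext h2 h3)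

/-- In a skew left brace the deformed map at `z` is a solution if and only if `z` is a right
distributor. Both conditions are equivalent to `(-x + y) * z = z - x * z + y * z`. -/
theorem yangBaxter_iff (h : ∀ x y z : G, x * (y + z) = x * y + -x + x * z) (z : G) :
    IsYangBaxterSolution (deformed z) ↔ ∀ a b : G, (a + b) * z = a * z + -z + b * z := by
  have h0 : (0 : G) * z = z := by rw [zero_eq_one h, one_mul]
  have expand : ∀ a b c, sigma z (sigma z a b) (sigma z (tau z b a) c) =
      -((-(a * z) + a * b * z) * z) + (-(a * z) + a * b * c * z) * z := by
    intro a b c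
    rw [sigma.eq_1 z (sigma z a b), sigma_mul_sigma h, sigma]
  rw [yangBaxter_iff_fst h]
  constructor
  · intro H
    have key : ∀ x y : G, (-x + y) * z = z + -(x * z) + y * z := by
      intro x y
      -- these arguments make `b * z` and `b * c * z` equal to `z + x` and `z + y`
      have := H 1 ((z + x) * z⁻¹) (((z + x) * z⁻¹)⁻¹ * ((z + y) * z⁻¹))
      rw [expand] at this
      simp only [sigma, one_mul, mul_inv_cancel_left, inv_mul_cancel_right, neg_add_rev,
        neg_add_cancel_left, add_assoc] at this
      rw [add_assoc z, this, add_neg_cancel_left]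
    intro a b
    have h1 := key a 0
    rw [add_zero, h0] at h1
    have h2 := key (-a) b
    rw [neg_neg, h1] at h2
    rw [h2]
    simp [add_assoc]
  · intro D a b c
    have key : ∀ x y : G, (-x + y) * z = z + -(x * z) + y * z := by
      intro x y
      have h1 := D x (-x)
      have h2 := D (-x) y
      rw [add_neg_cancel, h0] at h1
      rw [h2, eq_neg_add_of_add_eq h1.symm]
      simp [add_assoc]
    rw [expand, key, key, sigma, sigma, mul_assoc a (_ + _) z, key, add_assoc z, h, h,
      mul_neg_eq h]
    simp [add_assoc, mul_assoc]

end SkewBrace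

namespace DualWeakLeftStarBrace

variable {S : Type*} [DualWeakLeftStarBrace S]

/-! ### Reduction to maximal subgroups -/

/-- Compression to any projection carries the deformed map at `z` to the one at `p * z * p`. -/
lemma compress_deformedMap {p : S} (hp : IsStarProjection p) (z : S) (t : S × S) :
    Prod.map (fun x => p * x * p) (fun x => p * x * p) (deformedMap z t) =
      deformedMap (p * z * p) (Prod.map (fun x => p * x * p) (fun x => p * x * p) t) := by
  simp only [deformedMap, deformedTau, deformedSigma, Prod.map, compress_mul hp, compress_add hp,
    compress_neg hp, compress_star hp]

lemma val_deformedMap {p : {p : S // IsStarProjection p}} (z : MaxSubgroup p)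
    (t : MaxSubgroup p × MaxSubgroup p) :
    Prod.map MaxSubgroup.val MaxSubgroup.val (SkewBrace.deformed z t) =
      deformedMap z.val (Prod.map MaxSubgroup.val MaxSubgroup.val t) := by
  have h : ∀ a b : MaxSubgroup p,
      (SkewBrace.sigma z a b).val = deformedSigma z.val a.val b.val := by
    intro a b
    rw [deformedSigma, mul_assoc _ (star z.val), MaxSubgroup.star_mul_val]
    exact (MaxSubgroup.compress_val (SkewBrace.sigma z a b)).symm
  refine Prod.ext (h t.1 t.2) ?_
  change star (SkewBrace.sigma z t.1 t.2).val * _ * _ = _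
  rw [h]
  rfl

lemma source_mul_deformedSigma (z a b : S) :
    star z * z * deformedSigma z a b = deformedSigma z a b := by
  simp only [deformedSigma, ← mul_assoc, star_mul_star]

lemma deformedSigma_mul_source (z a b : S) :
    deformedSigma z a b * (star z * z) = deformedSigma z a b := by
  rw [deformedSigma, mul_assoc _ (star z) z, mul_assoc, (isStarProjection_star_mul z).1.eq]

lemma source_mul_deformedTau (z b a : S) :
    star z * z * deformedTau z b a = deformedTau z b a := by
  have h := congrArg star (deformedSigma_mul_source z a b)
  rw [star_mul, (isStarProjection_star_mul z).2.star_eq] at h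
  rw [deformedTau, ← mul_assoc, ← mul_assoc, h]

lemma deformedTau_mul {k b : S} (hb : b * k = b) (z a : S) :
    deformedTau z b a * k = deformedTau z b a := by
  rw [deformedTau, mul_assoc, hb]

lemma range_star_mul_source (z y : S) :
    star z * y * star (star z * y) * (star z * z) = star z * y * star (star z * y) := by
  rw [star_mul, star_star, mul_assoc, mul_assoc (star y), ← mul_assoc z, mul_star_mul]

lemma eq_of_compress_eq {p e k w w' : S} (hp : IsStarProjection p) (he : IsStarProjection e)
    (hk : IsStarProjection k) (hpe : p * e = p) (hw : e * w = w) (hwk : w * k = w)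
    (hs : w * star w * p * (w * star w) = w * star w) (hw' : e * w' = w') (hwk' : w' * k = w')
    (hs' : w' * star w' * p * (w' * star w') = w' * star w') (h : p * w * p = p * w' * p) :
    w = w' := by
  rw [eq_compress_mul hp he hk hpe hw hwk hs, eq_compress_mul hp he hk hpe hw' hwk' hs', h]

lemma rightDistributor_of_yangBaxter {z : S} (H : IsYangBaxterSolution (deformedMap z)) :
    z ∈ rightDistributors S := by
  intro a b
  obtain ⟨q, hq⟩ : ∃ q, q = star z * (a * b) := ⟨_, rfl⟩
  have pp := isStarProjection_mul_star q
  obtain ⟨p, hp⟩ : ∃ p : {p : S // IsStarProjection p}, p.1 = q * star q := ⟨⟨_, pp⟩, rfl⟩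
  have hsupp := supp_self q
  rw [← hp] at hsupp pp
  rw [hq, supp_mul pp, supp_mul pp, supp_star pp] at hsupp
  obtain ⟨sz, sa, sb⟩ := hsupp
  have hH : IsYangBaxterSolution (SkewBrace.deformed (MaxSubgroup.ofSupp z sz)) := by
    funext t
    have vi := MaxSubgroup.val_injective (p := p)
    apply vi.prodMap (vi.prodMap vi)
    have h1 := congrArg (Prod.map (fun x : S => p.1 * x * p) (Prod.map (fun x => p.1 * x * p)
      (fun x => p.1 * x * p))) (congrFun H (Prod.map MaxSubgroup.val
        (Prod.map MaxSubgroup.val MaxSubgroup.val) t))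
    simp only [Function.comp_apply, map_applyFirstTwo (compress_deformedMap pp z),
      map_applyLastTwo (compress_deformedMap pp z)] at h1
    simp only [Function.comp_apply, map_applyFirstTwo (val_deformedMap (MaxSubgroup.ofSupp z sz)),
      map_applyLastTwo (val_deformedMap (MaxSubgroup.ofSupp z sz))]
    simpa only [Prod.map, MaxSubgroup.compress_val, MaxSubgroup.val_ofSupp] using h1
  have hD := congrArg MaxSubgroup.val ((SkewBrace.yangBaxter_iff MaxSubgroup.mul_add_eq _).1 hH
    (MaxSubgroup.ofSupp a sa) (MaxSubgroup.ofSupp b sb))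
  simp only [MaxSubgroup.val_mul, MaxSubgroup.val_add, MaxSubgroup.val_neg,
    MaxSubgroup.val_ofSupp, ← compress_add pp, ← compress_mul pp, ← compress_neg pp] at hD
  -- both sides start in the range of `b` and end in the source of `z`
  have pk := isStarProjection_mul_star b
  have pe := isStarProjection_star_mul z
  have ze : z * (star z * z) = z := by rw [← mul_assoc, mul_star_mul]
  have hpe : p.1 * (star z * z) = p := by
    rw [hp, hq, range_star_mul_source]
  have bb : b + b * star b = b := by rw [← neg_add_self', ← add_assoc, add_neg_add]
  have l1 : b * star b * ((a + b) * z) = (a + b) * z := by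
    rw [← mul_assoc, proj_mul _ pk, add_assoc, bb]
  have l2 : b * star b * (a * z + -z + b * z) = a * z + -z + b * z := by
    rw [proj_mul _ pk, add_assoc, ← proj_mul _ pk, ← mul_assoc, mul_star_mul]
  have r1 : (a + b) * z * (star z * z) = (a + b) * z := by rw [mul_assoc, ze]
  have r2 : (a * z + -z + b * z) * (star z * z) = a * z + -z + b * z := by
    rw [mul_proj _ pe, ← add_assoc, ← add_assoc, ← mul_proj _ pe, mul_assoc, ze]
  have key : ∀ w : S, (∀ d : S, IsStarProjection d → Supp d w → Supp d q) →
      star w * star (star w) * p * (star w * star (star w)) = star w * star (star w) := by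
    intro w hw
    have pd := isStarProjection_mul_star (star w)
    rw [hp]
    exact hw _ pd ((supp_star pd w).1 (supp_self (star w)))
  -- `eq_of_compress_eq` wants `p` below the left end, which is `star z * z` only after taking stars
  apply star_injective
  refine eq_of_compress_eq pp pe pk hpe ?_ ?_ (key _ ?_) ?_ ?_ (key _ ?_) ?_
  · simpa using congrArg star r1
  · simpa using congrArg star l1
  · intro d pd
    simp only [hq, supp_mul pd, supp_add pd, supp_star pd]
    tauto
  · simpa using congrArg star r2
  · simpa using congrArg star l2
  · intro d pd
    simp only [hq, supp_mul pd, supp_add pd, supp_neg pd, supp_star pd]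
    tauto
  · rw [compress_star pp, compress_star pp, hD]

lemma yangBaxter_of_rightDistributor {z : S} (hz : z ∈ rightDistributors S) :
    IsYangBaxterSolution (deformedMap z) := by
  funext ⟨a, b, c⟩
  obtain ⟨q, hq⟩ : ∃ q, q = star z * (a * (b * c)) := ⟨_, rfl⟩
  have pp := isStarProjection_mul_star q
  obtain ⟨p, hp⟩ : ∃ p : {p : S // IsStarProjection p}, p.1 = q * star q := ⟨⟨_, pp⟩, rfl⟩
  have hsupp := supp_self q
  rw [← hp] at hsupp pp
  rw [hq, supp_mul pp, supp_mul pp, supp_mul pp, supp_star pp] at hsupp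
  obtain ⟨sz, sa, sb, sc⟩ := hsupp
  have hH : IsYangBaxterSolution (SkewBrace.deformed (MaxSubgroup.ofSupp z sz)) := by
    refine (SkewBrace.yangBaxter_iff MaxSubgroup.mul_add_eq _).2 fun x y => ?_
    apply MaxSubgroup.val_injective
    have h := congrArg (fun x : S => p.1 * x * p) (hz x.val y.val)
    simp only [compress_add pp, compress_mul pp, compress_neg pp, MaxSubgroup.compress_val] at h
    exact h
  have hYB := congrArg (Prod.map MaxSubgroup.val (Prod.map MaxSubgroup.val MaxSubgroup.val))
    (congrFun hH (MaxSubgroup.ofSupp a sa, MaxSubgroup.ofSupp b sb, MaxSubgroup.ofSupp c sc))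
  simp only [Function.comp_apply, map_applyFirstTwo (val_deformedMap (MaxSubgroup.ofSupp z sz)),
    map_applyLastTwo (val_deformedMap (MaxSubgroup.ofSupp z sz))] at hYB
  have hC : Prod.map (fun x => p.1 * x * p) (Prod.map (fun x => p.1 * x * p)
      (fun x => p.1 * x * p)) ((applyFirstTwo (deformedMap z) ∘ applyLastTwo (deformedMap z) ∘
        applyFirstTwo (deformedMap z)) (a, b, c)) =
      Prod.map (fun x => p.1 * x * p) (Prod.map (fun x => p.1 * x * p)
      (fun x => p.1 * x * p)) ((applyLastTwo (deformedMap z) ∘ applyFirstTwo (deformedMap z) ∘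
        applyLastTwo (deformedMap z)) (a, b, c)) := by
    simp only [Function.comp_apply, map_applyFirstTwo (compress_deformedMap pp z),
      map_applyLastTwo (compress_deformedMap pp z)]
    exact hYB
  have pe := isStarProjection_star_mul z
  have pk := isStarProjection_star_mul c
  have hpe : p.1 * (star z * z) = p := by
    rw [hp, hq, range_star_mul_source]
  have cc : c * (star c * c) = c := by rw [← mul_assoc, mul_star_mul]
  have key : ∀ w : S, (∀ d : S, IsStarProjection d → Supp d w → Supp d q) →
      w * star w * p * (w * star w) = w * star w := by
    intro w hw
    rw [hp]
    exact hw _ (isStarProjection_mul_star w) (supp_self w)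
  obtain ⟨h1, h2, h3⟩ := Prod.ext_iff.1 hC |>.imp id Prod.ext_iff.1
  -- all components start under `star z * z`; the first two also end under it, the third ends
  -- under `star c * c`
  refine Prod.ext ?_ (Prod.ext ?_ ?_)
  · refine eq_of_compress_eq pp pe pe hpe (source_mul_deformedSigma _ _ _)
      (deformedSigma_mul_source _ _ _) (key _ ?_) (source_mul_deformedSigma _ _ _)
      (deformedSigma_mul_source _ _ _) (key _ ?_) h1 <;>
    · intro d pd
      simp only [hq, Function.comp_apply, applyFirstTwo, applyLastTwo, deformedMap, supp_sigma pd,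
        supp_tau pd, supp_mul pd, supp_star pd]
      tauto
  · refine eq_of_compress_eq pp pe pe hpe (source_mul_deformedTau _ _ _)
      (deformedTau_mul (deformedSigma_mul_source _ _ _) _ _) (key _ ?_)
      (source_mul_deformedSigma _ _ _) (deformedSigma_mul_source _ _ _) (key _ ?_) h2 <;>
    · intro d pd
      simp only [hq, Function.comp_apply, applyFirstTwo, applyLastTwo, deformedMap, supp_sigma pd,
        supp_tau pd, supp_mul pd, supp_star pd]
      tauto
  · refine eq_of_compress_eq pp pe pk hpe (source_mul_deformedTau _ _ _)
      (deformedTau_mul cc _ _) (key _ ?_) (source_mul_deformedTau _ _ _)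
      (deformedTau_mul (deformedTau_mul cc _ _) _ _) (key _ ?_) h3 <;>
    · intro d pd
      simp only [hq, Function.comp_apply, applyFirstTwo, applyLastTwo, deformedMap, supp_sigma pd,
        supp_tau pd, supp_mul pd, supp_star pd]
      tauto

end DualWeakLeftStarBrace

theorem theorem4p6 {S : Type*} [DualWeakLeftStarBrace S] (z : S) :
    IsYangBaxterSolution (deformedMap z) ↔ z ∈ rightDistributors S :=
  ⟨DualWeakLeftStarBrace.rightDistributor_of_yangBaxter,
    DualWeakLeftStarBrace.yangBaxter_of_rightDistributor⟩
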